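/- Consider a team of finitely many agents $i=1,\dots,N$. Agent $i$ is modelled by a Markov decision process with finite state set $\mathcal S^i$, finite action set $\mathcal A^i$, initial state $s_I^i$ and transition function $\mathcal T^i:\mathcal S^i\times\mathcal A^i\to\Delta(\mathcal S^i)$. Let $\boldsymbol{\mathcal S}=\prod_i\mathcal S^i$, $\boldsymbol{\mathcal A}=\prod_i\mathcal A^i$, $\boldsymbol s_I=(s_I^1,\dots,s_I^N)$ and $\boldsymbol{\mathcal T}(\boldsymbol s,\boldsymbol a,\boldsymbol y)=\prod_i\mathcal T^i(s^i,a^i,y^i)$, and let $\pi:\boldsymbol{\mathcal S}\to\Delta(\boldsymbol{\mathcal A})$ be a stationary joint policy. *Full communication.* $\boldsymbol\Gamma^{full}$ is the law of the joint path $\boldsymbol s_0\boldsymbol a_0\boldsymbol s_1\boldsymbol a_1\dots$ with $\boldsymbol s_0=\boldsymbol s_I$, $\boldsymbol a_t\sim\pi(\boldsymbol s_t)$ and $\boldsymbol s_{t+1}\sim\boldsymbol{\mathcal T}(\boldsymbol s_t,\boldsymbol a_t)$. *Imaginary play.* Let $f:(\boldsymbol{\mathcal S}\times\boldsymbol{\mathcal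 A})^*\to\{0,1\}$ be an arbitrary function; communication is available at time $t$ if and only if $f(\boldsymbol s_0\boldsymbol a_0\dots\boldsymbol s_{t-1}\boldsymbol a_{t-1})=1$, where the argument is the actual joint history. Let $t_{loss}\in\{0,1,\dots\}\cup\{\infty\}$ be the first time at which communication is unavailable; from then on the agents do not communicate again. For $t<t_{loss}$ the agents play as under full communication. From time $t_{loss}$ on, every agent $i$ keeps, independently of the other agents, imaginary copies of its teammates: at each time $t\ge t_{loss}$ it has a joint state $\hat{\boldsymbol s}_{t,i}$ whose $i$-th component is its own actual state $s^i_t$; $\hat{\boldsymbol s}_{t,i}=\boldsymbol s_I$ if $t=0$, and otherwise $\hat{\boldsymbol s}_{t,i}\sim\boldsymbol{\mathcal T}(\hat{\boldsymbol s}_{t-1,i},\hat{\boldsymbol a}_{t-1,i})$ (where, for $t=t_{loss}\ge 1$, $\hat{\boldsymbol s}_{t-1,i}$ and $\hat{\boldsymbol a}_{t-1,i}$ are the last shared joint state and joint action). It samples $\hat{\boldsymbol a}_{t,i}\sim\pi(\hat{\boldsymbol s}_{t,i})$ and executes the local part $a^i_t=\hat a^i_{t,i}$. Let $\boldsymbol\Gamma^{img}_f$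 be the law of the actual joint path. *Reach-avoid probability.* For $\boldsymbol{\mathcal S}_{\mathcal T},\boldsymbol{\mathcal S}_{\mathcal A}\subseteq\boldsymbol{\mathcal S}$, let $\boldsymbol v^{full}$ and $\boldsymbol v^{img}$ be the probabilities under $\boldsymbol\Gamma^{full}$ and $\boldsymbol\Gamma^{img}_f$ that there is an $m\ge0$ with $\boldsymbol s_m\in\boldsymbol{\mathcal S}_{\mathcal T}$ and $\boldsymbol s_t\notin\boldsymbol{\mathcal S}_{\mathcal A}$ for all $t<m$. *Total correlation.* Let $\boldsymbol X=(X^1,\dots,X^N)\sim\boldsymbol\Gamma^{full}$, where $X^i=s^i_0a^i_0s^i_1a^i_1\dots$ is the path of agent $i$. Let $C_\pi\in[0,\infty]$ be the Kullback–Leibler divergence (natural logarithm) of the joint law of $(X^1,\dots,X^N)$ from the product of the laws of $X^1,\dots,X^N$. Let $H(Y)=\mathbb E[-\log \Pr_Y(\{Y\})]\in[0,\infty]$, with $\Pr_Y$ the law of $Y$, denote Shannon entropy (so $H(Y)=\infty$ if $Y$ is not discrete). **Theorem.** In $[0,\infty]$ one has $C_\pi+H(\boldsymbol X)=\sum_{i=1}^N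 H(X^i)$; in particular $C_\pi=\sum_{i=1}^N H(X^i)-H(\boldsymbol X)$ whenever $H(\boldsymbol X)<\infty$. Moreover, for every availability function $f$ and all $\boldsymbol{\mathcal S}_{\mathcal T},\boldsymbol{\mathcal S}_{\mathcal A}$, $$\boldsymbol v^{img}\ \ge\ \boldsymbol v^{full}-\sqrt{1-\exp(-C_\pi)},\qquad \exp(-\infty)=0 .$$ -/

import Mathlib

open MeasureTheory ProbabilityTheory
open scoped ENNReal

namespace ImaginaryPlay

noncomputable section

/-! ### Probability preliminaries -/

/-- The distribution of a family of independent random variables with laws `p i`. -/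
def piPMF {ι : Type*} [Fintype ι] [DecidableEq ι] {X : ι → Type*} [∀ i, Fintype (X i)]
    (p : ∀ i, PMF (X i)) : PMF (∀ i, X i) :=
  PMF.ofFintype (fun x => ∏ i, p i (x i)) (by
    rw [← Fintype.prod_sum fun i y => p i y]
    refine Finset.prod_eq_one fun i _ => ?_
    rw [← tsum_fintype (L := .unconditional _)]
    exact (p i).tsum_coe)

/-- The kernel that reads the symbols produced up to time `n` as a finite word and draws the
next symbol from `step`. -/
def stepKernel {X : Type*} [Finite X] [MeasurableSpace X] [MeasurableSingletonClass X]
    (step : List X → PMF X) (n : ℕ) : Kernel ((_k : Finset.Iic n) → X) X :=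
  Kernel.ofFunOfCountable fun x =>
    (step (List.ofFn fun k : Fin (n + 1) =>
      x ⟨k, Finset.mem_Iic.2 (Nat.lt_succ_iff.1 k.2)⟩)).toMeasure

instance {X : Type*} [Finite X] [MeasurableSpace X] [MeasurableSingletonClass X]
    (step : List X → PMF X) (n : ℕ) : IsMarkovKernel (stepKernel step n) :=
  ⟨fun _ => PMF.toMeasure.isProbabilityMeasure _⟩

/-- The law, on infinite words over a finite alphabet, of the process whose next symbol has
conditional distribution `step w` given that the word produced so far is `w`. -/
def processLaw {X : Type*} [Finite X] [MeasurableSpace X] [MeasurableSingletonClass X]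
    (step : List X → PMF X) : Measure (ℕ → X) :=
  Kernel.trajMeasure (X := fun _ => X) (step []).toMeasure (stepKernel step)

/-- Shannon entropy (in nats) of a random variable with law `μ`, that is, the expectation of
`-log μ {x}` under `μ`. It equals `∑ x, -μ {x} * log μ {x}` if `μ` is carried by a countable set,
and it is `∞` if `μ` has an atomless part. -/
def entropy {X : Type*} [MeasurableSpace X] (μ : Measure X) : ℝ≥0∞ :=
  ∫⁻ x, (-ENNReal.log (μ {x})).toENNReal ∂μ

/-! ### Markov games and joint policies -/

/-- The Markov decision process of one agent: initial state and transition function. -/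
structure MDP (S A : Type*) where
  init : S
  trans : S → A → PMF S

section Game

variable {ι : Type*} [Fintype ι] [DecidableEq ι] {S A : ι → Type*}
  [∀ i, Fintype (S i)] [∀ i, Fintype (A i)]

/-- Joint states. -/
abbrev JState (S : ι → Type*) := ∀ i, S i

/-- Joint actions. -/
abbrev JAction (A : ι → Type*) := ∀ i, A i

/-- Pairs of a joint state and a joint action. -/
abbrev JPair (S A : ι → Type*) := JState S × JAction A

/-- The joint transition function: the agents move independently. -/
def jointTrans (M : ∀ i, MDP (S i) (A i)) (x : JPair S A) : PMF (JState S) :=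
  piPMF fun i => (M i).trans (x.1 i) (x.2 i)

/-- One round: the joint state is the initial one at time `0` (no previous pair), and is sampled
from the joint transition function at the previous state-action pair otherwise; then a joint
action is sampled from the joint policy. -/
def sampleRound (M : ∀ i, MDP (S i) (A i)) (π : JState S → PMF (JAction A)) :
    Option (JPair S A) → PMF (JPair S A)
  | none => (π fun i => (M i).init).map fun a => (fun i => (M i).init, a)
  | some x => (jointTrans M x).bind fun s => (π s).map fun a => (s, a)

/-- The local path `s^i_0 a^i_0 s^i_1 a^i_1 …` of agent `i` in a joint path. -/
def localPath (i : ι) (ξ : ℕ → JPair S A) : ℕ → S i × A i :=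
  fun t => ((ξ t).1 i, (ξ t).2 i)

/-- The joint paths that reach `T` while avoiding `B` before. -/
def reachAvoid (T B : Set (JState S)) : Set (ℕ → JPair S A) :=
  {ξ | ∃ m, (ξ m).1 ∈ T ∧ ∀ t < m, (ξ t).1 ∉ B}

/-! ### Imaginary play -/

/-- The joint state and joint action of the team according to each agent. The entry of agent `i`
is `(ŝ_{t,i}, â_{t,i})`, its own state `s^i_t` being the true one. -/
abbrev Views (S A : ι → Type*) := ι → JPair S A

/-- The true joint state and the executed joint action: agent `i` is in the state `s^i_t` and
executes the local part `â^i_{t,i}` of the joint action it has decided on. -/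
def actual (v : Views S A) : JPair S A :=
  (fun i => (v i).1 i, fun i => (v i).2 i)

/-- One time step of imaginary play, after the time steps recorded in `h`, when communication
is available after a joint history `w` if and only if `f w = true`, and is not recovered once it
is lost. If communication is still available, the agents share their true states and jointly
decide on an action, so that all views are the actual pair. Otherwise every agent, independently
of the other agents, continues with its imaginary teammates. -/
def imaginaryStep (M : ∀ i, MDP (S i) (A i)) (π : JState S → PMF (JAction A))
    (f : List (JPair S A) → Bool) (h : List (Views S A)) : PMF (Views S A) :=
  if ∀ k ≤ h.length, f ((h.map actual).take k) = true then
    (sampleRound M π ((h.map actual).getLast?)).map fun x _ => x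
  else
    piPMF fun i => sampleRound M π ((h.map fun v => v i).getLast?)

variable [∀ i, MeasurableSpace (S i)] [∀ i, MeasurableSingletonClass (S i)]
  [∀ i, MeasurableSpace (A i)] [∀ i, MeasurableSingletonClass (A i)]

/-- The distribution of joint paths under full communication. -/
def fullLaw (M : ∀ i, MDP (S i) (A i)) (π : JState S → PMF (JAction A)) :
    Measure (ℕ → JPair S A) :=
  processLaw fun h => sampleRound M π h.getLast?

/-- The distribution of (actual) joint paths under imaginary play with communication
availability dictated by `f`. -/
def imaginaryLaw (M : ∀ i, MDP (S i) (A i)) (π : JState S → PMF (JAction A))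
    (f : List (JPair S A) → Bool) : Measure (ℕ → JPair S A) :=
  (processLaw (imaginaryStep M π f)).map fun c t => actual (c t)

/-- Total correlation of the local paths of the agents under full communication: the
Kullback-Leibler divergence of their joint law from the product of their laws. -/
def totalCorrelation (M : ∀ i, MDP (S i) (A i)) (π : JState S → PMF (JAction A)) : ℝ≥0∞ :=
  InformationTheory.klDiv
    ((fullLaw M π).map fun ξ i => localPath i ξ)
    (Measure.pi fun i => (fullLaw M π).map (localPath i))

end Game

end

end ImaginaryPlay

/-!
The identity between total correlation and entropies is checked atom by atom. If every local path
has a discrete law, then so has the joint path, and `klDiv_add_entropy` sums an identity between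
nonnegative numbers (`klFun_atom`) over the atoms. Otherwise some local entropy is infinite, and so
is the joint entropy, because an atom of the joint law projects to an atom of every marginal.

For the reach-avoid bound, the reach-avoid event is the increasing union of events that depend on
the first `n` rounds, so it suffices to bound the loss for these. On words of length `n`, let `P` be
the law of full communication, `R` the product of its marginals for the single agents, and `Q` the
law of the actual word under imaginary play. Two facts relate them.

* Under imaginary play, the view of every single agent is a copy of the full communication process,
  and it coincides with the actual word until communication is lost. Hence `P` and `Q` give the same
  joint law to the word up to the loss and the local word of any one agent
  (`sum_imaginaryProb_mul_eq`).
* After the loss the agents are independent, so that `Q w` is a product of a function of the word up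
  to the loss and of functions of this word and the local word of one agent (`imaginaryProb_eq`).

So `log (R / Q)` is a sum of functions whose expectations under `P` and `Q` agree, and its
expectation under `Q` is nonpositive by Gibbs' inequality. This gives the Pythagorean inequality
`KL(P ‖ Q) ≤ KL(P ‖ R)` (`sum_fullProb_log_le`). By the data processing inequality `KL(P ‖ R)` is at
most the total correlation, and the Bretagnolle-Huber inequality (`bretagnolle_huber`) turns this
into the bound on probabilities.
-/

namespace ImaginaryPlay

/-! ### Entropy and relative entropy of discrete measures -/

section Entropy

variable {X : Type*} [MeasurableSpace X] [MeasurableSingletonClass X]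

theorem countable_atoms (μ : Measure X) [IsFiniteMeasure μ] : {x | μ {x} ≠ 0}.Countable := by
  have h := Measure.countable_meas_pos_of_disjoint_iUnion (μ := μ) (As := fun x : X => {x})
    (fun x => measurableSet_singleton x) (fun x y hxy => by simpa using hxy)
  simpa [pos_iff_ne_zero] using h

theorem measurable_measure_singleton (μ : Measure X) [IsFiniteMeasure μ] :
    Measurable fun x => μ {x} := by
  refine measurable_of_Ici fun a => ?_
  rcases eq_or_ne a 0 with rfl | ha
  · simp
  · refine ((countable_atoms μ).mono fun x hx => ?_).measurableSet
    exact (lt_of_lt_of_le (pos_iff_ne_zero.2 ha) hx).ne'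

theorem measurable_surprisal : Measurable fun p : ℝ≥0∞ => (-ENNReal.log p).toENNReal :=
  measurable_ereal_toENNReal.comp ENNReal.measurable_log.neg

theorem entropy_map {Ω : Type*} [MeasurableSpace Ω] (μ : Measure Ω) [IsFiniteMeasure μ]
    {f : Ω → X} (hf : Measurable f) :
    entropy (μ.map f) = ∫⁻ ω, (-ENNReal.log (μ.map f {f ω})).toENNReal ∂μ :=
  lintegral_map (measurable_surprisal.comp (measurable_measure_singleton _)) hf

theorem entropy_eq_top {μ : Measure X} [IsFiniteMeasure μ] (h : μ {x | μ {x} = 0} ≠ 0) :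
    entropy μ = ∞ := by
  have hm : MeasurableSet {x | μ {x} = 0} :=
    measurable_measure_singleton μ (measurableSet_singleton 0)
  refine top_le_iff.1 ?_
  calc ∞ = ∫⁻ x in {x | μ {x} = 0}, ∞ ∂μ := by simp [ENNReal.top_mul h]
    _ = ∫⁻ x in {x | μ {x} = 0}, (-ENNReal.log (μ {x})).toENNReal ∂μ :=
      setLIntegral_congr_fun hm fun x hx => by
        have hx : μ {x} = 0 := hx
        simp [hx]
    _ ≤ _ := setLIntegral_le_lintegral _ _

theorem surprisal_prod {ι : Type*} (s : Finset ι) (p : ι → ℝ≥0∞) (hp : ∀ i ∈ s, p i ≤ 1) :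
    (-ENNReal.log (∏ i ∈ s, p i)).toENNReal = ∑ i ∈ s, (-ENNReal.log (p i)).toENNReal := by
  classical
  induction s using Finset.induction_on with
  | empty => simp
  | insert a s ha ih =>
    have h1 : p a ≤ 1 := hp a (by simp)
    have hs : ∀ i ∈ s, p i ≤ 1 := fun i hi => hp i (by simp [hi])
    have h2 : ∏ i ∈ s, p i ≤ 1 := Finset.prod_le_one' hs
    rw [Finset.prod_insert ha, Finset.sum_insert ha, ← ih hs, ← ENNReal.log_inv,
      ENNReal.mul_inv (Or.inr (ne_top_of_le_ne_top ENNReal.one_ne_top h2))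
        (Or.inl (ne_top_of_le_ne_top ENNReal.one_ne_top h1)),
      ENNReal.log_mul_add, ENNReal.log_inv, ENNReal.log_inv,
      EReal.toENNReal_add (by simpa using h1) (by simpa using h2)]

theorem lintegral_eq_tsum_of_ae_mem {μ : Measure X} {D : Set X} (hD : D.Countable)
    (h : ∀ᵐ x ∂μ, x ∈ D) (g : X → ℝ≥0∞) : ∫⁻ x, g x ∂μ = ∑' x : D, g x * μ {(x : X)} := by
  rw [← lintegral_countable g hD, Measure.restrict_eq_self_of_ae_mem h]

/-- The contribution of one atom to the relation between relative entropy and entropy: with the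
density `r = m / n`, it reads `n * (r log r + 1 - r) - m log m + m = - m log n + n`. All terms are
nonnegative, which is what allows summing it over the atoms in `[0, ∞]`. -/
theorem klFun_atom {r n m : ℝ≥0∞} (hn : n ≤ 1) (hm : m ≤ 1) (hr : r * n = m) :
    ENNReal.ofReal (InformationTheory.klFun r.toReal) * n + (-ENNReal.log m).toENNReal * m + m =
      (-ENNReal.log n).toENNReal * m + n := by
  have hn' := ne_top_of_le_ne_top ENNReal.one_ne_top hn
  have hm' := ne_top_of_le_ne_top ENNReal.one_ne_top hm
  rcases eq_or_ne n 0 with rfl | hn0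
  · simp at hr; subst hr; simp
  rcases eq_or_ne m 0 with rfl | hm0
  · have : r = 0 := by simpa [hn0] using hr
    subst this; simp [InformationTheory.klFun_zero]
  have key : ∀ {p : ℝ≥0∞}, p ≤ 1 → p ≠ 0 → (-ENNReal.log p).toENNReal =
      ENNReal.ofReal (-Real.log p.toReal) := fun {p} h1 h0 => by
    rw [ENNReal.log_pos_real h0 (ne_top_of_le_ne_top ENNReal.one_ne_top h1),
      ← EReal.coe_neg, EReal.toENNReal_of_ne_top (EReal.coe_ne_top _), EReal.toReal_coe]
  have hpos : ∀ {p : ℝ≥0∞}, p ≤ 1 → 0 ≤ -Real.log p.toReal := fun {p} h1 =>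
    neg_nonneg.2 (Real.log_nonpos ENNReal.toReal_nonneg
      (ENNReal.toReal_le_of_le_ofReal zero_le_one (by simpa using h1)))
  rw [key hm hm0, key hn hn0]
  have hr0 : r ≠ 0 := by rintro rfl; simp at hr; exact hm0 hr.symm
  have hr' : r ≠ ∞ := by rintro rfl; rw [ENNReal.top_mul hn0] at hr; exact hm' hr.symm
  lift n to NNReal using hn'
  lift r to NNReal using hr'
  have hrp : (0 : ℝ) < r := by
    have : r ≠ 0 := by simpa using hr0
    positivity
  have hnp : (0 : ℝ) < n := by
    have : n ≠ 0 := by simpa using hn0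
    positivity
  subst hr
  have hkl := InformationTheory.klFun_nonneg hrp.le
  have h1 := hpos hm
  have h2 := hpos hn
  simp only [ENNReal.toReal_mul, ENNReal.coe_toReal] at h1 h2 ⊢
  rw [← ENNReal.ofReal_coe_nnreal (p := n), ← ENNReal.ofReal_coe_nnreal (p := r),
    ← ENNReal.ofReal_mul hrp.le, ← ENNReal.ofReal_mul hkl, ← ENNReal.ofReal_mul h1,
    ← ENNReal.ofReal_mul h2, ← ENNReal.ofReal_add (by positivity) (by positivity),
    ← ENNReal.ofReal_add (by positivity) (by positivity),
    ← ENNReal.ofReal_add (by positivity) (by positivity),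
    InformationTheory.klFun_apply, Real.log_mul hrp.ne' hnp.ne']
  congr 1
  ring

/-- For probability measures carried by a countable set, relative entropy plus entropy is the
cross entropy. -/
theorem klDiv_add_entropy {μ ν : Measure X} [IsProbabilityMeasure μ] [IsProbabilityMeasure ν]
    {D : Set X} (hD : D.Countable) (hμ : ∀ᵐ x ∂μ, x ∈ D) (hν : ∀ᵐ x ∂ν, x ∈ D)
    (hac : ∀ x, ν {x} = 0 → μ {x} = 0) :
    InformationTheory.klDiv μ ν + entropy μ = ∫⁻ x, (-ENNReal.log (ν {x})).toENNReal ∂μ := by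
  have hμν : μ ≪ ν := by
    intro s hs
    have h0 : μ (s ∩ D) = 0 := by
      rw [← Set.biUnion_of_singleton (s ∩ D),
        measure_biUnion_null_iff (hD.mono Set.inter_subset_right)]
      exact fun x hx => hac x (measure_mono_null (by simpa using hx.1) hs)
    rw [← Set.inter_union_sdiff s D]
    exact measure_union_null h0 (measure_mono_null (fun x hx => hx.2) hμ)
  rw [InformationTheory.klDiv_eq_lintegral_klFun_of_ac hμν]
  have h1 : ∑' x : D, μ {(x : X)} = 1 := by
    simpa using (lintegral_eq_tsum_of_ae_mem hD hμ fun _ => 1).symm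
  have h2 : ∑' x : D, ν {(x : X)} = 1 := by
    simpa using (lintegral_eq_tsum_of_ae_mem hD hν fun _ => 1).symm
  -- The atomwise identity has an extra `μ {x}` on the left and `ν {x}` on the right.
  refine (ENNReal.add_left_inj ENNReal.one_ne_top).1 ?_
  unfold entropy
  rw [lintegral_eq_tsum_of_ae_mem hD hν, lintegral_eq_tsum_of_ae_mem hD hμ,
    lintegral_eq_tsum_of_ae_mem hD hμ]
  nth_rw 1 [← h1]
  rw [← h2, ← ENNReal.tsum_add, ← ENNReal.tsum_add, ← ENNReal.tsum_add]
  refine tsum_congr fun x => klFun_atom prob_le_one prob_le_one ?_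
  have := Measure.setLIntegral_rnDeriv hμν {(x : X)}
  rwa [lintegral_singleton] at this

/-- Relative entropy with respect to the product of the marginals, plus joint entropy, is the sum
of the marginal entropies. -/
theorem klDiv_pi_add_entropy {ι : Type*} [Fintype ι] {E : ι → Type*}
    [∀ i, MeasurableSpace (E i)] [∀ i, MeasurableSingletonClass (E i)]
    (μ : Measure (∀ i, E i)) [IsProbabilityMeasure μ] :
    InformationTheory.klDiv μ (Measure.pi fun i => μ.map fun x => x i) + entropy μ =
      ∑ i, entropy (μ.map fun x => x i) := by
  have hp : ∀ i, IsProbabilityMeasure (μ.map fun x => x i) := fun i =>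
    Measure.isProbabilityMeasure_map (measurable_pi_apply i).aemeasurable
  by_cases hd : ∀ i, ∀ᵐ y ∂(μ.map fun x => x i), (μ.map fun x => x i) {y} ≠ 0
  · have hD : {x : ∀ i, E i | ∀ i, x i ∈ {y | (μ.map fun x => x i) {y} ≠ 0}}.Countable :=
      Set.countable_pi fun i => countable_atoms _
    rw [klDiv_add_entropy hD (ae_all_iff.2 fun i => ae_of_ae_map
        (measurable_pi_apply i).aemeasurable (hd i))
      (ae_all_iff.2 fun i => (Measure.quasiMeasurePreserving_eval _ i).ae (hd i)) ?_]
    · simp_rw [entropy_map μ (measurable_pi_apply _)]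
      rw [← lintegral_finsetSum (f := fun i (x : ∀ i, E i) =>
          (-ENNReal.log ((μ.map fun x => x i) {x i})).toENNReal) _ fun i _ =>
        measurable_surprisal.comp
          ((measurable_measure_singleton _).comp (measurable_pi_apply i))]
      simp_rw [Measure.pi_singleton, surprisal_prod _ _ fun _ _ => prob_le_one]
    · intro x hx
      rw [Measure.pi_singleton, Finset.prod_eq_zero_iff] at hx
      obtain ⟨i, -, hi⟩ := hx
      rw [Measure.map_apply (measurable_pi_apply i) (measurableSet_singleton _)] at hi
      exact measure_mono_null (by rintro _ rfl; rfl) hi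
  · push Not at hd
    obtain ⟨i, hi⟩ := hd
    have hi' : (μ.map fun x => x i) {y | (μ.map fun x => x i) {y} = 0} ≠ 0 :=
      frequently_ae_iff.1 hi
    have hm : MeasurableSet {y | (μ.map fun x => x i) {y} = 0} :=
      measurable_measure_singleton _ (measurableSet_singleton 0)
    have htop : entropy (μ.map fun x => x i) = ∞ := entropy_eq_top hi'
    have hμ : entropy μ = ∞ := by
      refine entropy_eq_top fun h => hi' ?_
      rw [Measure.map_apply (measurable_pi_apply i) hm]
      refine measure_mono_null (fun x hx => ?_) h
      have hx : (μ.map fun x => x i) {x i} = 0 := hx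
      rw [Measure.map_apply (measurable_pi_apply i) (measurableSet_singleton _)] at hx
      exact measure_mono_null (by rintro _ rfl; rfl) hx
    rw [hμ, add_top, eq_comm, ENNReal.sum_eq_top]
    exact ⟨i, Finset.mem_univ i, htop⟩

theorem entropy_map_measurableEquiv {X Y : Type*} [MeasurableSpace X]
    [MeasurableSpace Y] [MeasurableSingletonClass Y]
    (μ : Measure X) [IsFiniteMeasure μ] (e : X ≃ᵐ Y) : entropy (μ.map e) = entropy μ := by
  rw [entropy_map μ e.measurable]
  refine lintegral_congr fun x => ?_
  rw [e.map_apply]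
  congr
  ext y
  simp

end Entropy

/-! ### Finite words of a process -/

section Words

/-- The probability that the process with next-symbol distributions `step` starts with the finite
word `x`. -/
noncomputable def wordProb {X : Type*} (step : List X → PMF X) {n : ℕ} (x : Fin n → X) : ℝ :=
  ∏ k : Fin n, (step ((List.ofFn x).take k) (x k)).toReal

variable {X : Type*} (step : List X → PMF X)

theorem wordProb_nonneg {n : ℕ} (x : Fin n → X) : 0 ≤ wordProb step x :=
  Finset.prod_nonneg fun _ _ => ENNReal.toReal_nonneg

theorem ofFn_snoc {n : ℕ} (x : Fin n → X) (a : X) :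
    List.ofFn (Fin.snoc x a : Fin (n + 1) → X) = List.ofFn x ++ [a] := by
  rw [List.ofFn_succ', List.concat_eq_append]
  simp

theorem wordProb_snoc {n : ℕ} (x : Fin n → X) (a : X) :
    wordProb step (Fin.snoc x a : Fin (n + 1) → X) =
      wordProb step x * (step (List.ofFn x) a).toReal := by
  unfold wordProb
  rw [Fin.prod_univ_castSucc, ofFn_snoc]
  congr 1
  · refine Finset.prod_congr rfl fun k _ => ?_
    rw [Fin.snoc_castSucc, List.take_append_of_le_length (by simp)]
    rfl
  · simp

theorem sum_snoc [Fintype X] {n : ℕ} (F : (Fin (n + 1) → X) → ℝ) :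
    ∑ x, F x = ∑ x : Fin n → X, ∑ a, F (Fin.snoc x a) := by
  rw [← (Fin.snocEquiv fun _ : Fin (n + 1) => X).sum_comp, Fintype.sum_prod_type_right]
  rfl

theorem sum_toReal_pmf [Fintype X] (p : PMF X) : ∑ a, (p a).toReal = 1 := by
  rw [← ENNReal.toReal_sum fun a _ => p.apply_ne_top a, ← tsum_fintype (L := .unconditional _),
    p.tsum_coe, ENNReal.toReal_one]

theorem sum_map_pmf [Fintype X] {Y : Type*} [Fintype Y] (p : PMF X) (φ : X → Y) (G : Y → ℝ) :
    ∑ a, (p a).toReal * G (φ a) = ∑ b, (p.map φ b).toReal * G b := by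
  classical
  have h : ∀ b, (p.map φ b).toReal = ∑ a, if b = φ a then (p a).toReal else 0 := fun b => by
    rw [PMF.map_apply, tsum_fintype, ENNReal.toReal_sum]
    · exact Finset.sum_congr rfl fun a _ => by split_ifs <;> simp
    · intro a _
      split_ifs
      exacts [p.apply_ne_top a, ENNReal.zero_ne_top]
  simp_rw [h, Finset.sum_mul]
  rw [Finset.sum_comm]
  simp

/-- If `φ` maps the next symbol of one process to the next symbol of another one, whenever the
history has positive probability, then it maps the words of the first process to those of the
second one. -/
theorem sum_wordProb_map [Fintype X] {Y : Type*} [Fintype Y] (step' : List Y → PMF Y) (φ : X → Y)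
    (h : ∀ (n : ℕ) (x : Fin n → X), wordProb step x ≠ 0 →
      (step (List.ofFn x)).map φ = step' ((List.ofFn x).map φ))
    {n : ℕ} (G : (Fin n → Y) → ℝ) :
    ∑ x, wordProb step x * G (φ ∘ x) = ∑ y, wordProb step' y * G y := by
  induction n with
  | zero =>
    simp only [wordProb, Finset.univ_eq_empty, Finset.prod_empty, Finset.univ_unique,
      Finset.sum_singleton]
    congr 2
    exact Subsingleton.elim _ _
  | succ n ih =>
    rw [sum_snoc, sum_snoc]
    simp_rw [wordProb_snoc, mul_assoc, ← Finset.mul_sum]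
    rw [← ih fun y => ∑ b, (step' (List.ofFn y) b).toReal * G (Fin.snoc y b)]
    refine Finset.sum_congr rfl fun x _ => ?_
    by_cases hx : wordProb step x = 0
    · simp [hx]
    congr 1
    rw [← List.map_ofFn, ← h n x hx,
      ← sum_map_pmf (step (List.ofFn x)) φ fun b => G (Fin.snoc (φ ∘ x) b)]
    simp_rw [Fin.comp_snoc]

theorem sum_wordProb [Fintype X] (n : ℕ) : ∑ x : Fin n → X, wordProb step x = 1 := by
  induction n with
  | zero => simp [wordProb]
  | succ n ih =>
    rw [sum_snoc]
    simp_rw [wordProb_snoc, ← Finset.mul_sum, sum_toReal_pmf, mul_one, ih]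

variable [Fintype X] [MeasurableSpace X] [MeasurableSingletonClass X]

instance : IsProbabilityMeasure (processLaw step) := by
  unfold processLaw; infer_instance

theorem processLaw_map_zero : (processLaw step).map (fun ξ => ξ 0) = (step []).toMeasure := by
  have h : (processLaw step).map (Preorder.frestrictLe 0) =
      (step []).toMeasure.map
        (MeasurableEquiv.piUnique fun _ : Finset.Iic (0 : ℕ) => X).symm := by
    rw [processLaw, Kernel.trajMeasure, Measure.map_comp _ _ (by fun_prop),
      Kernel.traj_map_frestrictLe, Kernel.partialTraj_self, Measure.id_comp]
  have h2 := congrArg (Measure.map fun y : Finset.Iic (0 : ℕ) → X => y ⟨0, by simp⟩) h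
  rw [Measure.map_map (by fun_prop) (by fun_prop), Measure.map_map (by fun_prop) (by fun_prop)]
    at h2
  rw [← Measure.map_id (μ := (step []).toMeasure)]
  exact h2

theorem processLaw_word {n : ℕ} (x : Fin n → X) :
    (processLaw step).real {ξ | ∀ k : Fin n, ξ k = x k} = wordProb step x := by
  induction n with
  | zero => simp [wordProb]
  | succ n ih =>
    obtain ⟨y, a, rfl⟩ : ∃ y a, x = Fin.snoc y a := ⟨_, _, (Fin.snoc_init_self x).symm⟩
    rw [wordProb_snoc]
    have hset : {ξ : ℕ → X | ∀ k : Fin (n + 1), ξ k = (Fin.snoc y a : Fin (n + 1) → X) k} =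
        {ξ | (∀ k : Fin n, ξ k = y k) ∧ ξ n = a} := by
      ext ξ
      simp [Fin.forall_fin_succ']
    rw [hset]
    rcases n with _ | n
    · have h := congrArg (fun μ : Measure X => μ.real {a}) (processLaw_map_zero step)
      rw [map_measureReal_apply (measurable_pi_apply 0) (measurableSet_singleton a),
        measureReal_def (step []).toMeasure, PMF.toMeasure_apply_singleton _ _
        (measurableSet_singleton a)] at h
      simp [wordProb, ← h]
      rfl
    · rw [← ih]
      have h := Kernel.map_frestrictLe_trajMeasure_compProd_eq_map_trajMeasure (X := fun _ => X)
        (κ := stepKernel step) (μ₀ := (step []).toMeasure) (a := n)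
      let z : Finset.Iic n → X := fun k => y ⟨k, Nat.lt_succ_iff.2 (Finset.mem_Iic.1 k.2)⟩
      have hz : Preorder.frestrictLe (π := fun _ => X) n ⁻¹' {z} =
          {ξ : ℕ → X | ∀ k : Fin (n + 1), ξ k = y k} := by
        ext ξ
        simp only [Set.mem_preimage, Set.mem_singleton_iff, Set.mem_ofPred_eq, funext_iff,
          Subtype.forall, Finset.mem_Iic, z, Preorder.frestrictLe_apply]
        exact ⟨fun h k => h k (Nat.lt_succ_iff.1 k.2), fun h k hk => h ⟨k, Nat.lt_succ_iff.2 hk⟩⟩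
      have h2 := DFunLike.congr_fun h ({z} ×ˢ {a})
      rw [Measure.compProd_apply_prod (measurableSet_singleton _) (measurableSet_singleton _),
        lintegral_singleton, Measure.map_apply (by fun_prop) (measurableSet_singleton _),
        Measure.map_apply (by fun_prop)
          ((measurableSet_singleton _).prod (measurableSet_singleton _)), hz] at h2
      have hk : stepKernel step n z {a} = step (List.ofFn y) a := by
        change (step _).toMeasure {a} = _
        rw [PMF.toMeasure_apply_singleton _ _ (measurableSet_singleton a)]
      have hset2 : (fun ξ : ℕ → X => (Preorder.frestrictLe (π := fun _ => X) n ξ, ξ (n + 1))) ⁻¹'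
          ({z} ×ˢ {a}) = {ξ | (∀ k : Fin (n + 1), ξ k = y k) ∧ ξ (n + 1) = a} := by
        rw [Set.mk_preimage_prod, hz]
        rfl
      rw [hk, hset2] at h2
      rw [measureReal_def, measureReal_def, processLaw, ← h2, ENNReal.toReal_mul, mul_comm]

theorem processLaw_prefix {n : ℕ} (E : Set (Fin n → X)) [DecidablePred (· ∈ E)] :
    (processLaw step).real {ξ | (fun k : Fin n => ξ k) ∈ E} =
      ∑ x, if x ∈ E then wordProb step x else 0 := by
  have hm : Measurable fun (ξ : ℕ → X) (k : Fin n) => ξ k := by fun_prop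
  have h := sum_measureReal_singleton (μ := (processLaw step).map fun ξ (k : Fin n) => ξ k)
    (Finset.univ.filter (· ∈ E))
  rw [Finset.sum_filter, map_measureReal_apply hm (Finset.measurableSet _)] at h
  simp_rw [map_measureReal_apply hm (measurableSet_singleton _)] at h
  have hE : {ξ : ℕ → X | (fun k : Fin n => ξ k) ∈ E} = (fun (ξ : ℕ → X) (k : Fin n) => ξ k) ⁻¹'
      ((Finset.univ.filter (· ∈ E) : Finset (Fin n → X)) : Set (Fin n → X)) := by
    ext; simp
  rw [hE, ← h]
  refine Finset.sum_congr rfl fun x _ => ?_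
  rw [← processLaw_word]
  congr 2
  ext ξ
  simp [funext_iff]

end Words

/-! ### Information inequalities on a finite space -/

section Information

variable {W : Type*} [Fintype W] {P Q R : W → ℝ}

/-- The Bretagnolle-Huber inequality on a finite space. -/
theorem bretagnolle_huber (hP : ∀ w, 0 ≤ P w) (hQ : ∀ w, 0 ≤ Q w) (hP1 : ∑ w, P w = 1)
    (hQ1 : ∑ w, Q w = 1) (hPQ : ∀ w, P w ≠ 0 → Q w ≠ 0) (E : W → Prop) [DecidablePred E] :
    (∑ w, if E w then P w else 0) - (∑ w, if E w then Q w else 0) ≤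
      √(1 - Real.exp (-∑ w, P w * Real.log (P w / Q w))) := by
  set K := ∑ w, P w * Real.log (P w / Q w) with hK
  set c := ∑ w, √(P w) * √(Q w) with hc
  -- Jensen's inequality bounds the Bhattacharyya coefficient `c` from below.
  have hjensen : Real.exp (-K / 2) ≤ c := by
    have h := convexOn_exp.map_sum_le (t := Finset.univ) (w := P)
      (p := fun w => -Real.log (P w / Q w) / 2) (fun w _ => hP w) hP1 fun _ _ => Set.mem_univ _
    have h1 : ∑ w, P w • (-Real.log (P w / Q w) / 2) = -K / 2 := by
      rw [hK, ← Finset.sum_neg_distrib, Finset.sum_div]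
      exact Finset.sum_congr rfl fun w _ => by rw [smul_eq_mul]; ring
    rw [h1] at h
    refine h.trans (Finset.sum_le_sum fun w _ => le_of_eq ?_)
    rcases (hP w).eq_or_lt with h0 | h0
    · simp [← h0]
    have h0' : 0 < Q w := lt_of_le_of_ne (hQ w) (hPQ w h0.ne').symm
    have hs : Real.exp (-Real.log (P w / Q w) / 2) = √(Q w) / √(P w) := by
      rw [← Real.sqrt_div' _ h0.le, ← Real.log_inv, inv_div, ← Real.log_sqrt (by positivity),
        Real.exp_log (by positivity)]
    have hsq := Real.sq_sqrt h0.le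
    have hpos := Real.sqrt_pos.2 h0
    rw [hs, smul_eq_mul]
    field_simp
    rw [hsq]
  have hcexp : Real.exp (-K) ≤ c ^ 2 := by
    rw [show -K = -K / 2 + -K / 2 by ring, Real.exp_add, ← sq]
    exact pow_le_pow_left₀ (Real.exp_pos _).le hjensen 2
  -- The Cauchy-Schwarz inequality bounds the total variation distance in terms of `c`.
  have hsP : ∀ w, √(P w) ^ 2 = P w := fun w => Real.sq_sqrt (hP w)
  have hsQ : ∀ w, √(Q w) ^ 2 = Q w := fun w => Real.sq_sqrt (hQ w)
  have hcs := Finset.sum_mul_sq_le_sq_mul_sq Finset.univ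
    (fun w => (if E w then 1 else -1) * (√(P w) - √(Q w))) fun w => √(P w) + √(Q w)
  have e1 : ∑ w, ((if E w then 1 else -1) * (√(P w) - √(Q w))) ^ 2 = 2 - 2 * c := by
    have : ∀ w, ((if E w then 1 else -1) * (√(P w) - √(Q w))) ^ 2 =
        P w + Q w - 2 * (√(P w) * √(Q w)) := fun w => by
      split_ifs <;> linear_combination hsP w + hsQ w
    simp_rw [this, Finset.sum_sub_distrib, Finset.sum_add_distrib, ← Finset.mul_sum, hP1, hQ1]
    ring
  have e2 : ∑ w, (√(P w) + √(Q w)) ^ 2 = 2 + 2 * c := by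
    have : ∀ w, (√(P w) + √(Q w)) ^ 2 = P w + Q w + 2 * (√(P w) * √(Q w)) := fun w => by
      linear_combination hsP w + hsQ w
    simp_rw [this, Finset.sum_add_distrib, ← Finset.mul_sum, hP1, hQ1]
    ring
  have e3 : ∑ w, (if E w then 1 else -1) * (√(P w) - √(Q w)) * (√(P w) + √(Q w)) =
      2 * ((∑ w, if E w then P w else 0) - ∑ w, if E w then Q w else 0) := by
    have : ∀ w, (if E w then 1 else -1) * (√(P w) - √(Q w)) * (√(P w) + √(Q w)) =
        2 * ((if E w then P w else 0) - if E w then Q w else 0) - (P w - Q w) := fun w => by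
      split_ifs
      · linear_combination hsP w - hsQ w
      · linear_combination hsQ w - hsP w
    simp_rw [this, Finset.sum_sub_distrib, ← Finset.mul_sum, Finset.sum_sub_distrib, hP1, hQ1]
    ring
  rw [e1, e2, e3] at hcs
  refine Real.le_sqrt_of_sq_le ?_
  nlinarith

/-- Pythagorean inequality for relative entropy: if `log (R / Q)` has the same expectation under
`P` and `Q`, then `Q` is closer to `P` than `R` is. -/
theorem sum_log_div_le (hQ : ∀ w, 0 ≤ Q w) (hR : ∀ w, 0 ≤ R w)
    (hQ1 : ∑ w, Q w = 1) (hR1 : ∑ w, R w = 1) (hPQ : ∀ w, P w ≠ 0 → Q w ≠ 0)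
    (hQR : ∀ w, Q w ≠ 0 → R w ≠ 0) {g : W → ℝ}
    (hg : ∀ w, Q w ≠ 0 → g w = Real.log (R w / Q w))
    (hgPQ : ∑ w, P w * g w = ∑ w, Q w * g w) :
    ∑ w, P w * Real.log (P w / Q w) ≤ ∑ w, P w * Real.log (P w / R w) := by
  have h1 : ∑ w, Q w * g w ≤ 0 := by
    calc ∑ w, Q w * g w ≤ ∑ w, (R w - Q w) := Finset.sum_le_sum fun w _ => by
          by_cases h0 : Q w = 0
          · simpa [h0] using hR w
          have hq : 0 < Q w := lt_of_le_of_ne (hQ w) (Ne.symm h0)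
          have hr : 0 < R w := lt_of_le_of_ne (hR w) (hQR w h0).symm
          have := mul_le_mul_of_nonneg_left
            (Real.log_le_sub_one_of_pos (div_pos hr hq)) hq.le
          rw [hg w h0]
          refine this.trans_eq ?_
          field_simp
      _ = 0 := by rw [Finset.sum_sub_distrib, hQ1, hR1, sub_self]
  have h2 : ∑ w, P w * Real.log (P w / Q w) =
      ∑ w, P w * Real.log (P w / R w) + ∑ w, P w * g w := by
    rw [← Finset.sum_add_distrib]
    refine Finset.sum_congr rfl fun w _ => ?_
    by_cases h0 : P w = 0
    · simp [h0]
    have hq := hPQ w h0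
    have hr := hQR w hq
    rw [hg w hq, Real.log_div h0 hq, Real.log_div h0 hr, Real.log_div hr hq]
    ring
  linarith

theorem toReal_klDiv_fintype [MeasurableSpace W] [MeasurableSingletonClass W] {μ ν : Measure W}
    [IsProbabilityMeasure μ] [IsProbabilityMeasure ν] (h : InformationTheory.klDiv μ ν ≠ ∞) :
    (InformationTheory.klDiv μ ν).toReal =
      ∑ w, μ.real {w} * Real.log (μ.real {w} / ν.real {w}) := by
  obtain ⟨hac, hint⟩ := InformationTheory.klDiv_ne_top_iff.1 h
  rw [InformationTheory.toReal_klDiv_of_measure_eq hac (by simp), integral_fintype hint]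
  refine Finset.sum_congr rfl fun w _ => ?_
  have hw := Measure.setLIntegral_rnDeriv hac {w}
  rw [lintegral_singleton] at hw
  by_cases h0 : μ.real {w} = 0
  · simp [h0]
  have hr : μ.real {w} = (μ.rnDeriv ν w).toReal * ν.real {w} := by
    rw [measureReal_def, ← hw, ENNReal.toReal_mul, measureReal_def]
  have hν : ν.real {w} ≠ 0 := fun h => h0 (by rw [hr, h, mul_zero])
  rw [smul_eq_mul, llr]
  nth_rw 3 [hr]
  rw [mul_div_cancel_right₀ _ hν]

end Information

/-! ### Finite words under imaginary play -/

section Availability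

variable {X : Type*} (f : List X → Bool)

/-- Communication has been available at all times up to the end of the history `l`. -/
def Available (l : List X) : Prop :=
  ∀ k ≤ l.length, f (l.take k) = true

/-- The words `w` and `w'` agree as long as communication is available, including the symbol
produced at the last time it is available. -/
def AgreeUntilLoss {n : ℕ} (w w' : Fin n → X) : Prop :=
  ∀ k : Fin n, Available f ((List.ofFn w).take k) → w k = w' k

variable {f}

theorem Available.take {l : List X} (h : Available f l) (j : ℕ) : Available f (l.take j) := by
  intro k hk
  rw [List.length_take] at hk
  rw [List.take_take, min_eq_left (by omega)]
  exact h k (by omega)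

theorem take_ofFn_congr {n : ℕ} {w w' : Fin n → X} {k : ℕ}
    (h : ∀ j : Fin n, (j : ℕ) < k → w j = w' j) :
    (List.ofFn w).take k = (List.ofFn w').take k := by
  refine List.ext_getElem (by simp) fun j hj _ => ?_
  simp only [List.length_take, List.length_ofFn] at hj
  simpa using h ⟨j, by omega⟩ (by simp; omega)

theorem AgreeUntilLoss.take_eq {n : ℕ} {w w' : Fin n → X} (h : AgreeUntilLoss f w w') {k : ℕ}
    (hk : Available f ((List.ofFn w).take k)) :
    (List.ofFn w).take k = (List.ofFn w').take k :=
  take_ofFn_congr fun j hj => h j (by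
    have := hk.take j
    rwa [List.take_take, min_eq_left hj.le] at this)

theorem AgreeUntilLoss.available_iff {n : ℕ} {w w' : Fin n → X} (h : AgreeUntilLoss f w w')
    (k : ℕ) : Available f ((List.ofFn w).take k) ↔ Available f ((List.ofFn w').take k) := by
  refine ⟨fun hk => h.take_eq hk ▸ hk, fun hk => ?_⟩
  induction k with
  | zero => simpa using hk
  | succ k ih =>
    have h1 : Available f ((List.ofFn w).take k) := ih (by
      have := hk.take k
      rwa [List.take_take, min_eq_left (Nat.le_succ k)] at this)
    have h2 : (List.ofFn w).take (k + 1) = (List.ofFn w').take (k + 1) :=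
      take_ofFn_congr fun j hj => h j (by
        have := h1.take j
        rwa [List.take_take, min_eq_left (Nat.lt_succ_iff.1 hj)] at this)
    rwa [h2]

end Availability

section Independent

variable {ι : Type*} [Fintype ι] [DecidableEq ι] {X : ι → Type*} [∀ i, Fintype (X i)]

theorem piPMF_apply (p : ∀ i, PMF (X i)) (x : ∀ i, X i) : piPMF p x = ∏ i, p i (x i) := rfl

theorem piPMF_map_eval (p : ∀ i, PMF (X i)) (i : ι) : (piPMF p).map (fun x => x i) = p i := by
  classical
  ext y
  rw [PMF.map_apply, tsum_fintype]
  have h := Fintype.prod_sum fun j (a : X j) =>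
    if h : j = i then (if y = h ▸ a then p j a else 0) else p j a
  calc ∑ x : ∀ j, X j, (if y = x i then piPMF p x else 0)
      = ∑ x : ∀ j, X j, ∏ j, (if h : j = i then (if y = h ▸ x j then p j (x j) else 0)
          else p j (x j)) := Finset.sum_congr rfl fun x _ => by
        by_cases hy : y = x i
        · rw [if_pos hy, piPMF_apply]
          refine Finset.prod_congr rfl fun j _ => ?_
          by_cases hj : j = i
          · subst hj; simp [hy]
          · simp [hj]
        · rw [if_neg hy, Finset.prod_eq_zero (Finset.mem_univ i)]
          simp [hy]
    _ = p i y := by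
        rw [← h, Finset.prod_eq_single i]
        · simp
        · intro j _ hj
          simp only [hj, dite_false]
          rw [← tsum_fintype (L := .unconditional _), (p j).tsum_coe]
        · simp

end Independent

section Play

variable {ι : Type*} [Fintype ι] [DecidableEq ι] {S A : ι → Type*}
  [∀ i, Fintype (S i)]

/-- The state and action of agent `i` in a joint state-action pair. -/
def localPair (i : ι) (x : JPair S A) : S i × A i := (x.1 i, x.2 i)

theorem jPair_ext {ι : Type*} {S A : ι → Type*} {x y : JPair S A}
    (h : ∀ i, localPair i x = localPair i y) : x = y :=
  Prod.ext (funext fun i => congrArg Prod.fst (h i)) (funext fun i => congrArg Prod.snd (h i))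

theorem localPair_actual {ι : Type*} {S A : ι → Type*} (i : ι) (v : Views S A) :
    localPair i (actual v) = localPair i (v i) :=
  rfl

open Classical in
theorem ite_forall_localPair_congr {ι : Type*} {S A : ι → Type*} {i : ι} {n : ℕ}
    {y w w' : Fin n → JPair S A} (hi : ∀ k, localPair i (w k) = localPair i (w' k)) (a : ℝ) :
    (if ∀ k, localPair i (y k) = localPair i (w k) then a else 0) =
      if ∀ k, localPair i (y k) = localPair i (w' k) then a else 0 :=
  if_congr (forall_congr' fun k => by rw [hi k]) rfl rfl

variable (M : ∀ i, MDP (S i) (A i)) (π : JState S → PMF (JAction A))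
  (f : List (JPair S A) → Bool)

/-- The probability of a joint word under full communication. -/
noncomputable def fullProb {n : ℕ} (w : Fin n → JPair S A) : ℝ :=
  wordProb (fun h => sampleRound M π h.getLast?) w

theorem fullProb_nonneg {n : ℕ} (w : Fin n → JPair S A) : 0 ≤ fullProb M π w :=
  wordProb_nonneg _ _

open Classical in
/-- The factor of the probability of a word of views that is due to the times at which
communication is available; `w` is the actual joint word. -/
noncomputable def sharedFactor {n : ℕ} (w : Fin n → JPair S A) : ℝ :=
  ∏ k : Fin n, if Available f ((List.ofFn w).take k) then
    (sampleRound M π ((List.ofFn w).take k).getLast? (w k)).toReal else 1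

theorem sharedFactor_congr {f : List (JPair S A) → Bool} {n : ℕ} {w w' : Fin n → JPair S A}
    (h : AgreeUntilLoss f w w') :
    sharedFactor M π f w = sharedFactor M π f w' := by
  unfold sharedFactor
  refine Finset.prod_congr rfl fun k _ => ?_
  by_cases hk : Available f ((List.ofFn w).take k)
  · rw [if_pos hk, if_pos ((h.available_iff k).1 hk), h.take_eq hk, h k hk]
  · rw [if_neg hk, if_neg (mt (h.available_iff k).2 hk)]

variable [∀ i, Fintype (A i)]

open Classical in
/-- The probability of a joint word of actual state-action pairs under imaginary play. -/
noncomputable def imaginaryProb {n : ℕ} (w : Fin n → JPair S A) : ℝ :=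
  ∑ v : Fin n → Views S A, if actual ∘ v = w then wordProb (imaginaryStep M π f) v else 0

open Classical in
/-- The probability under full communication that agent `i` has the same local word as in `w`. -/
noncomputable def marginalProb (i : ι) {n : ℕ} (w : Fin n → JPair S A) : ℝ :=
  ∑ w' : Fin n → JPair S A,
    if ∀ k, localPair i (w' k) = localPair i (w k) then fullProb M π w' else 0

theorem imaginaryStep_of_available {h : List (Views S A)} (hh : Available f (h.map actual)) :
    imaginaryStep M π f h = (sampleRound M π ((h.map actual).getLast?)).map fun x _ => x :=
  if_pos (by simpa [Available] using hh)

theorem imaginaryStep_of_not_available {h : List (Views S A)}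
    (hh : ¬ Available f (h.map actual)) :
    imaginaryStep M π f h = piPMF fun i => sampleRound M π ((h.map fun v => v i).getLast?) :=
  if_neg (by simpa [Available] using hh)

open Classical in
/-- The factor of the probability of a word of views that is due to an agent whose view is `y`:
the view has to be the actual joint word `w` while communication is available, and is a Markov
chain of its own afterwards. -/
noncomputable def viewFactor {n : ℕ} (w y : Fin n → JPair S A) : ℝ :=
  ∏ k : Fin n, if Available f ((List.ofFn w).take k) then (if y k = w k then 1 else 0) else
    (sampleRound M π ((List.ofFn y).take k).getLast? (y k)).toReal

open Classical in
/-- The sum of the factors due to agent `i`, over all views with the local word of agent `i` in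
`w`. -/
noncomputable def localFactor (i : ι) {n : ℕ} (w : Fin n → JPair S A) : ℝ :=
  ∑ y : Fin n → JPair S A,
    if ∀ k, localPair i (y k) = localPair i (w k) then viewFactor M π f w y else 0

theorem wordProb_imaginaryStep {n : ℕ} (v : Fin n → Views S A) :
    wordProb (imaginaryStep M π f) v = sharedFactor M π f (actual ∘ v) *
      ∏ i, viewFactor M π f (actual ∘ v) fun k => v k i := by
  classical
  unfold wordProb sharedFactor viewFactor
  rw [Finset.prod_comm, ← Finset.prod_mul_distrib]
  refine Finset.prod_congr rfl fun k _ => ?_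
  have hmap : ((List.ofFn v).take k).map actual = (List.ofFn (actual ∘ v)).take k := by
    rw [List.map_take, List.map_ofFn]
  by_cases hk : Available f ((List.ofFn (actual ∘ v)).take k)
  · rw [imaginaryStep_of_available M π f (by rwa [hmap]), hmap]
    simp only [hk, if_true]
    rw [PMF.map_apply, tsum_fintype]
    by_cases hv : v k = fun _ => actual (v k)
    · rw [Finset.sum_eq_single (actual (v k))]
      · rw [if_pos hv, Finset.prod_eq_one, mul_one]
        · rfl
        · intro i _
          exact if_pos (congrFun hv i)
      · intro x _ hx
        refine if_neg fun h => hx ?_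
        rw [h]
        rfl
      · simp
    · rw [Finset.sum_eq_zero, ENNReal.toReal_zero]
      · obtain ⟨i, hi⟩ := Function.ne_iff.1 hv
        rw [Finset.prod_eq_zero (Finset.mem_univ i) (if_neg hi), mul_zero]
      · intro x _
        refine if_neg fun h => hv ?_
        rw [h]
        rfl
  · rw [imaginaryStep_of_not_available M π f (by rwa [hmap]), piPMF_apply, ENNReal.toReal_prod]
    simp only [hk, if_false, one_mul]
    refine Finset.prod_congr rfl fun i _ => ?_
    rw [List.map_take, List.map_ofFn]
    rfl

/-- Given the word up to the loss of communication, the agents are independent. -/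
theorem imaginaryProb_eq {n : ℕ} (w : Fin n → JPair S A) :
    imaginaryProb M π f w = sharedFactor M π f w * ∏ i, localFactor M π f i w := by
  classical
  unfold imaginaryProb localFactor
  rw [Fintype.prod_sum, Finset.mul_sum,
    ← (Equiv.piComm fun (_ : Fin n) (_ : ι) => JPair S A).sum_comp]
  refine Finset.sum_congr rfl fun v _ => ?_
  have hv : actual ∘ v = w ↔ ∀ i k, localPair i (v k i) = localPair i (w k) :=
    ⟨fun h i k => by rw [← h]; rfl, fun h => funext fun k => jPair_ext fun i => h i k⟩
  by_cases h : actual ∘ v = w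
  · rw [if_pos h, wordProb_imaginaryStep, h]
    congr 1
    exact Finset.prod_congr rfl fun i _ => (if_pos (hv.1 h i)).symm
  · rw [if_neg h]
    obtain ⟨i, hi⟩ := not_forall.1 (mt hv.2 h)
    rw [Finset.prod_eq_zero (Finset.mem_univ i) (if_neg hi), mul_zero]

variable {f}

theorem localFactor_congr {n : ℕ} {w w' : Fin n → JPair S A} (h : AgreeUntilLoss f w w') {i : ι}
    (hi : ∀ k, localPair i (w k) = localPair i (w' k)) :
    localFactor M π f i w = localFactor M π f i w' := by
  unfold localFactor
  refine Finset.sum_congr rfl fun y _ => ?_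
  rw [ite_forall_localPair_congr hi]
  congr 1
  unfold viewFactor
  refine Finset.prod_congr rfl fun k _ => ?_
  by_cases hk : Available f ((List.ofFn w).take k)
  · rw [if_pos hk, if_pos ((h.available_iff k).1 hk), h k hk]
  · rw [if_neg hk, if_neg (mt (h.available_iff k).2 hk)]

/-- As long as communication is available, the views are the actual joint word. -/
theorem agreeUntilLoss_view {n : ℕ} {v : Fin n → Views S A}
    (hv : wordProb (imaginaryStep M π f) v ≠ 0) (i : ι) :
    AgreeUntilLoss f (actual ∘ v) fun k => v k i := by
  intro k hk
  rw [wordProb_imaginaryStep] at hv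
  have h := Finset.prod_ne_zero_iff.1 (right_ne_zero_of_mul hv) i (Finset.mem_univ i)
  have h2 := Finset.prod_ne_zero_iff.1 h k (Finset.mem_univ k)
  rw [if_pos hk] at h2
  by_contra hne
  exact h2 (if_neg (Ne.symm hne))

/-- The view of every single agent has the law of the joint word under full communication. -/
theorem sum_view {n : ℕ} (i : ι) (G : (Fin n → JPair S A) → ℝ) :
    ∑ v : Fin n → Views S A, wordProb (imaginaryStep M π f) v * G (fun k => v k i) =
      ∑ w, fullProb M π w * G w := by
  refine sum_wordProb_map (imaginaryStep M π f) (fun h => sampleRound M π h.getLast?)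
    (fun v => v i) (fun m v hv => ?_) G
  by_cases hf : Available f ((List.ofFn v).map actual)
  · have hagree := (agreeUntilLoss_view M π hv i).take_eq (k := m) (by
      rwa [List.take_of_length_le (by simp), ← List.map_ofFn])
    rw [List.take_of_length_le (by simp), List.take_of_length_le (by simp)] at hagree
    rw [imaginaryStep_of_available M π f hf, PMF.map_comp, List.map_ofFn, hagree, List.map_ofFn]
    exact PMF.map_id _
  · rw [imaginaryStep_of_not_available M π f hf]
    exact piPMF_map_eval _ i

theorem sum_imaginaryProb_mul {n : ℕ} (G : (Fin n → JPair S A) → ℝ) :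
    ∑ w, imaginaryProb M π f w * G w =
      ∑ v : Fin n → Views S A, wordProb (imaginaryStep M π f) v * G (actual ∘ v) := by
  classical
  unfold imaginaryProb
  simp_rw [Finset.sum_mul]
  rw [Finset.sum_comm]
  simp

/-- The joint law of the word up to the loss of communication and of the local word of one agent
is the same under full communication and under imaginary play. -/
theorem sum_imaginaryProb_mul_eq {n : ℕ} (i : ι) {G : (Fin n → JPair S A) → ℝ}
    (hG : ∀ w w', AgreeUntilLoss f w w' → (∀ k, localPair i (w k) = localPair i (w' k)) →
      G w = G w') :
    ∑ w, fullProb M π w * G w = ∑ w, imaginaryProb M π f w * G w := by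
  rw [sum_imaginaryProb_mul, ← sum_view (f := f) M π i]
  refine Finset.sum_congr rfl fun v _ => ?_
  by_cases hv : wordProb (imaginaryStep M π f) v = 0
  · rw [hv, zero_mul, zero_mul]
  · rw [hG _ _ (agreeUntilLoss_view M π hv i) fun k => localPair_actual i (v k)]

theorem imaginaryProb_nonneg {n : ℕ} (w : Fin n → JPair S A) : 0 ≤ imaginaryProb M π f w := by
  refine Finset.sum_nonneg fun v _ => ?_
  split_ifs
  exacts [wordProb_nonneg _ _, le_rfl]

theorem marginalProb_nonneg (i : ι) {n : ℕ} (w : Fin n → JPair S A) :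
    0 ≤ marginalProb M π i w := by
  refine Finset.sum_nonneg fun v _ => ?_
  split_ifs
  exacts [wordProb_nonneg _ _, le_rfl]

theorem sum_fullProb (n : ℕ) : ∑ w : Fin n → JPair S A, fullProb M π w = 1 :=
  sum_wordProb _ _

theorem sum_imaginaryProb (n : ℕ) : ∑ w : Fin n → JPair S A, imaginaryProb M π f w = 1 := by
  classical
  simpa [sum_wordProb] using sum_imaginaryProb_mul (n := n) (f := f) M π fun _ => 1

theorem imaginaryProb_ne_zero {n : ℕ} {w : Fin n → JPair S A} (hw : fullProb M π w ≠ 0) :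
    imaginaryProb M π f w ≠ 0 := by
  unfold fullProb wordProb at hw
  have hk := fun k => Finset.prod_ne_zero_iff.1 hw k (Finset.mem_univ k)
  rw [imaginaryProb_eq]
  refine mul_ne_zero (Finset.prod_ne_zero_iff.2 fun k _ => ?_)
    (Finset.prod_ne_zero_iff.2 fun i _ => ne_of_gt ?_)
  · split_ifs
    exacts [hk k, one_ne_zero]
  · have hnn : ∀ y, 0 ≤ viewFactor M π f w y := fun y => Finset.prod_nonneg fun k _ => by
      split_ifs
      exacts [zero_le_one, le_rfl, ENNReal.toReal_nonneg]
    have hpos : viewFactor M π f w w ≠ 0 := Finset.prod_ne_zero_iff.2 fun k _ => by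
      split_ifs with h1 h2
      exacts [one_ne_zero, absurd rfl h2, hk k]
    refine Finset.sum_pos' (fun y _ => ?_) ⟨w, Finset.mem_univ w, ?_⟩
    · split_ifs
      exacts [hnn y, le_rfl]
    · rw [if_pos fun _ => rfl]
      exact lt_of_le_of_ne (hnn w) hpos.symm

theorem marginalProb_congr (i : ι) {n : ℕ} {w w' : Fin n → JPair S A}
    (hi : ∀ k, localPair i (w k) = localPair i (w' k)) :
    marginalProb M π i w = marginalProb M π i w' := by
  exact Finset.sum_congr rfl fun y _ => ite_forall_localPair_congr hi _

theorem marginalProb_ne_zero (i : ι) {n : ℕ} {w : Fin n → JPair S A}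
    (hw : imaginaryProb M π f w ≠ 0) : marginalProb M π i w ≠ 0 := by
  classical
  have h := sum_imaginaryProb_mul_eq (f := f) M π i
    (G := fun w' => if ∀ k, localPair i (w' k) = localPair i (w k) then 1 else 0)
    fun w1 w2 _ h12 => if_congr (forall_congr' fun k => by rw [h12 k]) rfl rfl
  simp only [mul_ite, mul_one, mul_zero] at h
  rw [marginalProb]
  convert! (?_ : _ ≠ (0 : ℝ)) using 1
  rw [h]
  refine ne_of_gt (Finset.sum_pos' (fun y _ => ?_) ⟨w, Finset.mem_univ w, ?_⟩)
  · split_ifs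
    exacts [imaginaryProb_nonneg M π y, le_rfl]
  · rw [if_pos fun _ => rfl]
    exact lt_of_le_of_ne (imaginaryProb_nonneg M π w) hw.symm

/-- On words of a fixed length, the law of imaginary play is at least as close to the law of full
communication as the product of the laws of the agents. -/
theorem sum_fullProb_log_le [Nonempty ι] {n : ℕ}
    (h1 : ∑ w : Fin n → JPair S A, ∏ i, marginalProb M π i w = 1) :
    ∑ w : Fin n → JPair S A,
        fullProb M π w * Real.log (fullProb M π w / imaginaryProb M π f w) ≤
      ∑ w : Fin n → JPair S A,
        fullProb M π w * Real.log (fullProb M π w / ∏ i, marginalProb M π i w) := by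
  refine sum_log_div_le (g := fun w => (∑ i, (Real.log (marginalProb M π i w) -
      Real.log (localFactor M π f i w))) - Real.log (sharedFactor M π f w))
    (imaginaryProb_nonneg M π)
    (fun w => Finset.prod_nonneg fun i _ => marginalProb_nonneg M π i w)
    (sum_imaginaryProb M π n) h1 (fun w => imaginaryProb_ne_zero M π)
    (fun w hw => Finset.prod_ne_zero_iff.2 fun i _ => marginalProb_ne_zero M π i hw) ?_ ?_
  · intro w hw
    have hm : ∀ i ∈ Finset.univ, marginalProb M π i w ≠ 0 := fun i _ =>
      marginalProb_ne_zero M π i hw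
    have hw' := hw
    rw [imaginaryProb_eq] at hw'
    have hq : ∀ i ∈ Finset.univ, localFactor M π f i w ≠ 0 :=
      Finset.prod_ne_zero_iff.1 (right_ne_zero_of_mul hw')
    rw [Real.log_div (Finset.prod_ne_zero_iff.2 hm) hw, imaginaryProb_eq,
      Real.log_mul (left_ne_zero_of_mul hw') (right_ne_zero_of_mul hw'), Real.log_prod hm,
      Real.log_prod hq, Finset.sum_sub_distrib]
    ring
  · have hdist : ∀ P : (Fin n → JPair S A) → ℝ, ∀ (g : ι → (Fin n → JPair S A) → ℝ)
        (c : (Fin n → JPair S A) → ℝ),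
        ∑ w, P w * (∑ i, g i w - c w) = ∑ i, ∑ w, P w * g i w - ∑ w, P w * c w := by
      intro P g c
      rw [Finset.sum_comm]
      simp_rw [mul_sub, Finset.mul_sum, Finset.sum_sub_distrib]
    rw [hdist _ fun i w => _, hdist _ fun i w => _]
    congr 1
    · refine Finset.sum_congr rfl fun i _ => sum_imaginaryProb_mul_eq M π i fun w w' h hi => ?_
      rw [marginalProb_congr M π i hi, localFactor_congr M π h hi]
    · exact sum_imaginaryProb_mul_eq M π (Classical.arbitrary ι) fun w w' h _ => by
        rw [sharedFactor_congr M π h]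

end Play

/-! ### From finite words to paths -/

section Paths

variable {ι : Type*} [Fintype ι] [DecidableEq ι] {S A : ι → Type*}
  [∀ i, Fintype (S i)] [∀ i, MeasurableSpace (S i)] [∀ i, MeasurableSingletonClass (S i)]
  [∀ i, Fintype (A i)] [∀ i, MeasurableSpace (A i)] [∀ i, MeasurableSingletonClass (A i)]

/-- A joint path is the same thing as the family of the local paths of the agents. -/
def localPaths {ι : Type*} (S A : ι → Type*) [∀ i, MeasurableSpace (S i)]
    [∀ i, MeasurableSpace (A i)] : (ℕ → JPair S A) ≃ᵐ (∀ i, ℕ → S i × A i) where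
  toFun ξ i := localPath i ξ
  invFun z t := (fun i => (z i t).1, fun i => (z i t).2)
  left_inv _ := rfl
  right_inv _ := rfl
  measurable_toFun := by
    change Measurable fun (ξ : ℕ → JPair S A) i t => ((ξ t).1 i, (ξ t).2 i)
    fun_prop
  measurable_invFun := by
    change Measurable fun (z : ∀ i, ℕ → S i × A i) t => (fun i => (z i t).1, fun i => (z i t).2)
    fun_prop

variable (M : ∀ i, MDP (S i) (A i)) (π : JState S → PMF (JAction A))
  (f : List (JPair S A) → Bool)

instance : IsProbabilityMeasure (fullLaw M π) := by
  unfold fullLaw; infer_instance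

theorem measurable_localPath {ι : Type*} {S A : ι → Type*} [∀ i, MeasurableSpace (S i)]
    [∀ i, MeasurableSpace (A i)] (i : ι) :
    Measurable (localPath i : (ℕ → JPair S A) → ℕ → S i × A i) := by
  unfold localPath
  fun_prop

theorem measurable_actual {ι : Type*} {S A : ι → Type*} [∀ i, MeasurableSpace (S i)]
    [∀ i, MeasurableSpace (A i)] :
    Measurable fun (c : ℕ → Views S A) t => actual (c t) := by
  unfold actual
  fun_prop

instance : IsProbabilityMeasure (imaginaryLaw M π f) :=
  Measure.isProbabilityMeasure_map measurable_actual.aemeasurable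

instance (i : ι) : IsProbabilityMeasure ((fullLaw M π).map (localPath i)) :=
  Measure.isProbabilityMeasure_map (measurable_localPath i).aemeasurable

theorem totalCorrelation_add_entropy :
    totalCorrelation M π + entropy (fullLaw M π) =
      ∑ i, entropy ((fullLaw M π).map (localPath i)) := by
  have hp : IsProbabilityMeasure ((fullLaw M π).map (localPaths S A)) :=
    Measure.isProbabilityMeasure_map (localPaths S A).measurable.aemeasurable
  have h := klDiv_pi_add_entropy ((fullLaw M π).map (localPaths S A))
  have hm : ∀ i, (((fullLaw M π).map (localPaths S A)).map fun z => z i) =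
      (fullLaw M π).map (localPath i) := fun i =>
    Measure.map_map (measurable_pi_apply i) (localPaths S A).measurable
  simp_rw [hm, entropy_map_measurableEquiv] at h
  exact h

theorem fullLaw_prefix {n : ℕ} (E : Set (Fin n → JPair S A)) [DecidablePred (· ∈ E)] :
    (fullLaw M π).real {ξ | (fun k : Fin n => ξ k) ∈ E} =
      ∑ w, if w ∈ E then fullProb M π w else 0 :=
  processLaw_prefix _ E

theorem imaginaryLaw_prefix {n : ℕ} (E : Set (Fin n → JPair S A)) [DecidablePred (· ∈ E)] :
    (imaginaryLaw M π f).real {ξ | (fun k : Fin n => ξ k) ∈ E} =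
      ∑ w, if w ∈ E then imaginaryProb M π f w else 0 := by
  have hm : Measurable fun (ξ : ℕ → JPair S A) (k : Fin n) => ξ k := by fun_prop
  have h := processLaw_prefix (imaginaryStep M π f) {v : Fin n → Views S A | actual ∘ v ∈ E}
  rw [imaginaryLaw]
  refine ((map_measureReal_apply measurable_actual (hm (Set.toFinite E).measurableSet)).trans
    h).trans ?_
  have h2 := sum_imaginaryProb_mul (f := f) M π fun w => if w ∈ E then 1 else 0
  simp only [mul_ite, mul_one, mul_zero] at h2
  exact h2.symm

/-- The joint word of length `n` with which a family of local paths starts. -/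
def jointPrefix (n : ℕ) (z : ∀ i, ℕ → S i × A i) : Fin n → JPair S A :=
  fun k => (fun i => (z i k).1, fun i => (z i k).2)

theorem measurable_jointPrefix {ι : Type*} {S A : ι → Type*} [∀ i, MeasurableSpace (S i)]
    [∀ i, MeasurableSpace (A i)] (n : ℕ) :
    Measurable (jointPrefix n : (∀ i, ℕ → S i × A i) → Fin n → JPair S A) := by
  unfold jointPrefix
  fun_prop

theorem pi_jointPrefix {n : ℕ} (w : Fin n → JPair S A) :
    ((Measure.pi fun i => (fullLaw M π).map (localPath i)).map (jointPrefix n)).real {w} =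
      ∏ i, marginalProb M π i w := by
  classical
  have hset : jointPrefix n ⁻¹' {w} =
      Set.univ.pi fun i => {y : ℕ → S i × A i | ∀ k : Fin n, y k = localPair i (w k)} := by
    ext z
    simp only [Set.mem_preimage, Set.mem_singleton_iff, Set.mem_univ_pi, Set.mem_ofPred_eq]
    exact ⟨fun h i k => by rw [← h]; rfl, fun h => funext fun k => jPair_ext fun i => h i k⟩
  have hmeas : ∀ i, MeasurableSet {y : ℕ → S i × A i | ∀ k : Fin n, y k = localPair i (w k)} :=
    fun i => by
      rw [Set.ofPred_forall]
      exact MeasurableSet.iInter fun k =>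
        (measurable_pi_apply (X := fun _ : ℕ => S i × A i) k)
          (measurableSet_singleton (localPair i (w k)))
  rw [map_measureReal_apply (measurable_jointPrefix n) (measurableSet_singleton w), hset,
    measureReal_def, Measure.pi_pi, ENNReal.toReal_prod]
  refine Finset.prod_congr rfl fun i _ => ?_
  rw [Measure.map_apply (measurable_localPath i) (hmeas i)]
  refine (fullLaw_prefix M π
    {w' : Fin n → JPair S A | ∀ k, localPair i (w' k) = localPair i (w k)}).trans ?_
  unfold marginalProb
  refine Finset.sum_congr rfl fun w' _ => ?_
  congr

theorem full_jointPrefix {n : ℕ} (w : Fin n → JPair S A) :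
    (((fullLaw M π).map fun ξ i => localPath i ξ).map (jointPrefix n)).real {w} =
      fullProb M π w := by
  classical
  rw [map_measureReal_apply (measurable_jointPrefix n) (measurableSet_singleton w),
    map_measureReal_apply (measurable_pi_iff.2 fun i => measurable_localPath i)
      (measurable_jointPrefix n (measurableSet_singleton w))]
  refine (fullLaw_prefix M π {w}).trans ?_
  simp

/-- The bound for events that depend on a bounded number of rounds only. -/
theorem fullLaw_prefix_le [Nonempty ι] (hC : totalCorrelation M π ≠ ∞) {n : ℕ}
    (E : Set (Fin n → JPair S A)) :
    (fullLaw M π).real {ξ | (fun k : Fin n => ξ k) ∈ E} -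
        (imaginaryLaw M π f).real {ξ | (fun k : Fin n => ξ k) ∈ E} ≤
      √(1 - Real.exp (-(totalCorrelation M π).toReal)) := by
  classical
  set μ := ((fullLaw M π).map fun ξ i => localPath i ξ).map (jointPrefix n) with hμ
  set ν := (Measure.pi fun i => (fullLaw M π).map (localPath i)).map (jointPrefix n) with hν
  have hp : IsProbabilityMeasure ((fullLaw M π).map fun ξ i => localPath i ξ) :=
    Measure.isProbabilityMeasure_map
      (measurable_pi_iff.2 fun i => measurable_localPath i).aemeasurable
  have hpμ : IsProbabilityMeasure μ :=
    Measure.isProbabilityMeasure_map (measurable_jointPrefix n).aemeasurable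
  have hpν : IsProbabilityMeasure ν :=
    Measure.isProbabilityMeasure_map (measurable_jointPrefix n).aemeasurable
  have hle : InformationTheory.klDiv μ ν ≤ totalCorrelation M π :=
    InformationTheory.klDiv_map_le _ _ (measurable_jointPrefix n)
  have hkl := toReal_klDiv_fintype (ne_top_of_le_ne_top hC hle)
  simp_rw [hμ, full_jointPrefix, hν, pi_jointPrefix] at hkl
  have h1 : ∑ w : Fin n → JPair S A, ∏ i, marginalProb M π i w = 1 := by
    simp_rw [← pi_jointPrefix]
    rw [sum_measureReal_singleton]
    simp [← hν]
  rw [fullLaw_prefix, imaginaryLaw_prefix]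
  refine (bretagnolle_huber (fullProb_nonneg M π) (imaginaryProb_nonneg M π) (sum_fullProb M π n)
    (sum_imaginaryProb M π n) (fun w => imaginaryProb_ne_zero M π) (· ∈ E)).trans ?_
  refine Real.sqrt_le_sqrt (sub_le_sub_left (Real.exp_le_exp.2 (neg_le_neg ?_)) _)
  exact (sum_fullProb_log_le M π h1).trans (hkl ▸ ENNReal.toReal_mono hC hle)

/-- Paths that reach `T` within the first `n` rounds while avoiding `B` before. -/
def reachAvoidWithin {ι : Type*} {S A : ι → Type*} (T B : Set (JState S)) (n : ℕ) :
    Set (ℕ → JPair S A) :=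
  {ξ | ∃ m < n, (ξ m).1 ∈ T ∧ ∀ t < m, (ξ t).1 ∉ B}

theorem reachAvoidWithin_eq_prefix {ι : Type*} {S A : ι → Type*} (T B : Set (JState S)) (n : ℕ) :
    (reachAvoidWithin T B n : Set (ℕ → JPair S A)) = {ξ | (fun k : Fin n => ξ k) ∈
      {w : Fin n → JPair S A | ∃ m, (w m).1 ∈ T ∧ ∀ t < m, (w t).1 ∉ B}} := by
  ext ξ
  constructor
  · rintro ⟨m, hm, h1, h2⟩
    exact ⟨⟨m, hm⟩, h1, fun t ht => h2 t ht⟩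
  · rintro ⟨m, h1, h2⟩
    exact ⟨m, m.2, h1, fun t ht => h2 ⟨t, ht.trans m.2⟩ ht⟩

theorem tendsto_reachAvoidWithin {ι : Type*} {S A : ι → Type*} [∀ i, MeasurableSpace (S i)]
    [∀ i, MeasurableSpace (A i)] (μ : Measure (ℕ → JPair S A)) [IsFiniteMeasure μ]
    (T B : Set (JState S)) :
    Filter.Tendsto (fun n => μ.real (reachAvoidWithin T B n)) Filter.atTop
      (nhds (μ.real (reachAvoid T B))) := by
  have hU : (reachAvoid T B : Set (ℕ → JPair S A)) = ⋃ n, reachAvoidWithin T B n := by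
    ext ξ
    simp only [Set.mem_iUnion]
    constructor
    · rintro ⟨m, h⟩
      exact ⟨m + 1, m, Nat.lt_succ_self m, h⟩
    · rintro ⟨n, m, -, h⟩
      exact ⟨m, h⟩
  rw [hU]
  refine (ENNReal.tendsto_toReal (measure_ne_top μ _)).comp (tendsto_measure_iUnion_atTop ?_)
  rintro n n' hn ξ ⟨m, hm, h⟩
  exact ⟨m, hm.trans_le hn, h⟩

theorem reachAvoid_le (hC : totalCorrelation M π ≠ ∞) (T B : Set (JState S)) :
    (fullLaw M π).real (reachAvoid T B) - (imaginaryLaw M π f).real (reachAvoid T B) ≤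
      √(1 - Real.exp (-(totalCorrelation M π).toReal)) := by
  rcases isEmpty_or_nonempty ι with hι | hι
  · -- Without agents there is only one joint path.
    rcases Subsingleton.set_cases (p := fun s : Set (ℕ → JPair S A) => s = ∅ ∨ s = Set.univ)
      (Or.inl rfl) (Or.inr rfl) (reachAvoid T B) with h | h <;> simp [h]
  · refine le_of_tendsto' ((tendsto_reachAvoidWithin _ T B).sub (tendsto_reachAvoidWithin _ T B))
      fun n => ?_
    rw [reachAvoidWithin_eq_prefix]
    exact fullLaw_prefix_le M π f hC _

end Paths

end ImaginaryPlay

theorem mainTheorem1 {ι : Type*} [Fintype ι] [DecidableEq ι] {S A : ι → Type*}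
    [∀ i, Fintype (S i)] [∀ i, MeasurableSpace (S i)] [∀ i, MeasurableSingletonClass (S i)]
    [∀ i, Fintype (A i)] [∀ i, MeasurableSpace (A i)] [∀ i, MeasurableSingletonClass (A i)]
    (M : ∀ i, ImaginaryPlay.MDP (S i) (A i))
    (π : ImaginaryPlay.JState S → PMF (ImaginaryPlay.JAction A))
    (f : List (ImaginaryPlay.JPair S A) → Bool)
    (T B : Set (ImaginaryPlay.JState S)) :
    ImaginaryPlay.totalCorrelation M π + ImaginaryPlay.entropy (ImaginaryPlay.fullLaw M π) =
        ∑ i, ImaginaryPlay.entropy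
          ((ImaginaryPlay.fullLaw M π).map (ImaginaryPlay.localPath i)) ∧
      (ImaginaryPlay.imaginaryLaw M π f).real (ImaginaryPlay.reachAvoid T B) ≥
        (ImaginaryPlay.fullLaw M π).real (ImaginaryPlay.reachAvoid T B) -
          √(1 - (EReal.exp (-(ImaginaryPlay.totalCorrelation M π : EReal))).toReal) := by
  refine ⟨ImaginaryPlay.totalCorrelation_add_entropy M π, ?_⟩
  rw [ge_iff_le, sub_le_comm]
  by_cases hC : ImaginaryPlay.totalCorrelation M π = ∞
  · -- The right-hand side is `1` here.
    have h1 : (ImaginaryPlay.fullLaw M π).real (ImaginaryPlay.reachAvoid T B) ≤ 1 :=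
      measureReal_le_one
    have h2 : 0 ≤ (ImaginaryPlay.imaginaryLaw M π f).real (ImaginaryPlay.reachAvoid T B) :=
      measureReal_nonneg
    simp only [hC, EReal.coe_ennreal_top, EReal.neg_top, EReal.exp_bot, ENNReal.toReal_zero,
      sub_zero, Real.sqrt_one]
    linarith
  · have hexp : (EReal.exp (-(ImaginaryPlay.totalCorrelation M π : EReal))).toReal =
        Real.exp (-(ImaginaryPlay.totalCorrelation M π).toReal) := by
      rw [← EReal.coe_ennreal_toReal hC, ← EReal.coe_neg, EReal.exp_coe,
        ENNReal.toReal_ofReal (Real.exp_pos _).le]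
    rw [hexp]
    exact ImaginaryPlay.reachAvoid_le M π f hC T B
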